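/- Let $\Phi$ be a gain graph: a finite graph $\Gamma=(V,E)$, $n=|V|$ (multiple edges, loops, half edges with one endpoint and loose edges with none are allowed), whose links and loops carry gains in a lattice-ordered group $\mathfrak G$, reversal of an edge inverting its gain. Let $\mathfrak G$ act from the right by automorphisms on a commutative semigroup $\mathfrak W$, and let $h:V\to\mathfrak W$ be a weight function; write $(\Phi,h)$ for the weighted gain graph. A circle is (the edge set of) a connected 2-regular subgraph without half edges, so a loop is a circle of length $1$; its gain is the product of the gains of its edges as it is traversed once, and whether this is $1$ does not depend on the start or the direction. An edge set is balanced if it has no half edge and every circle in it has gain $1$. For $S\subseteq E$ let $\pi(S)$ be the set of vertex sets of the $c(S)$ components of $(V,S)$ (loose edges are not components), and $\pi_{\rm b}(S)$ the set of those $W\in\pi(S)$ for which the set $S{:}W$ of edges of $S$ with at least one endpoint in $W$ and none outside is balanced; $b(S)=|\pi_{\rm b}(S)|$. On each $W\in\pi_{\rm b}(S)$ the top switching function $\eta_S$ is the unique $\eta:W\to\mathfrak G$ such that $\eta(v)^{-1}g\,\eta(w)=1$ for every edge of $S{:}W$ with gain $g$ from $v$ to $w$, and $\bigwedge_{v\in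 W}\eta(v)=1$. Put $h/S(W)=\sum_{w\in W}h(w)\eta_S(w)$. With variables $\mathbf u=(u_k)_{k\in\mathfrak W}$, $v$, $z$, the total dichromatic polynomial is $$Q_{(\Phi,h)}(\mathbf u,v,z)=\sum_{S\subseteq E}v^{|S|-n+b(S)}z^{c(S)-b(S)}\prod_{W\in\pi_{\rm b}(S)}u_{h/S(W)} .$$ Let $M_0$ be the complete lift matroid of $\Phi$: the matroid on $E\cup\{e_0\}$ with rank function, for $S\subseteq E$, $\operatorname{rk}(S)=n-c(S)$ if $S$ is balanced, $\operatorname{rk}(S)=n-c(S)+1$ if $S$ is unbalanced, and $\operatorname{rk}(S\cup e_0)=n-c(S)+1$. The semimatroid of graph balance is the family of subsets of $E$ whose closure in $M_0$ does not contain $e_0$ (these are the balanced edge sets), with closure, circuits and independence taken from $M_0$. Its independent sets are the spanning forests of $\Phi$, i.e. the sets of links that contain no circle. Let $O$ be a linear order of $E$. An edge $e$ is externally active with respect to a spanning forest $F$ if $e\notin F$, $e$ is in the closure of $F$, and $e$ is the $O$-largest element of the unique circuit contained in $F\cup e$; $\epsilon(F)$ is the number of such edges. The forest expansion is $$F_{(\Phi,h),O}(\mathbf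 u,y)=\sum_{F}y^{\epsilon(F)}\prod_{W\in\pi(F)}u_{h/F(W)},$$ summed over all spanning forests $F$ of $\Phi$. Theorem. The forest expansion is independent of $O$. Indeed, for every linear order $O$ of $E$, $$F_{(\Phi,h),O}(\mathbf u,y)=Q_{(\Phi,h)}(\mathbf u,y-1,0).$$ -/

import Mathlib

/-- The data of an edge of a graph with vertex set `V` and gains in `G`.  `arc v w g` is an ordinary
edge (a link if `v ≠ w`, a loop if `v = w`) whose gain is `g` when it is oriented from `v` to `w`,
hence `g⁻¹` when it is oriented from `w` to `v`; the order of `v` and `w` is only a reference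
orientation.  A half edge has one endpoint, a loose edge has none; neither carries a gain. -/
inductive EdgeKind (V G : Type*) where
  | arc (v w : V) (g : G)
  | half (v : V)
  | loose

/-- A gain graph with vertex set `V`, edge set `E` and gain group `G`: multiple edges, loops, half
edges and loose edges are permitted. -/
structure GainGraph (V E G : Type*) where
  edge : E → EdgeKind V G

namespace GainGraph

section Basic

variable {V E G : Type*} [Group G] (Φ : GainGraph V E G)

def IsHalf (e : E) : Prop := ∃ v, Φ.edge e = .half v

def IsLoose (e : E) : Prop := Φ.edge e = .loose

/-- The set of endpoints of an edge. -/
def ends (e : E) : Set V :=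
  match Φ.edge e with
  | .arc v w _ => {v, w}
  | .half v => {v}
  | .loose => ∅

/-- `Φ.Step e v w g`: the edge `e` can be traversed from `v` to `w`, and its gain in that direction
is `g`. -/
inductive Step : E → V → V → G → Prop
  | fwd {e : E} {v w : V} {g : G} (h : Φ.edge e = .arc v w g) : Step e v w g
  | bwd {e : E} {v w : V} {g : G} (h : Φ.edge e = .arc v w g) : Step e w v g⁻¹

/-- Walks; every edge of a walk is traversed in a definite direction. -/
inductive Walk : V → V → Type _
  | nil (v : V) : Walk v v
  | cons {v w x : V} (e : E) (g : G) (h : Φ.Step e v w g) (p : Walk w x) : Walk v x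

namespace Walk

variable {Φ}

def edges : {v w : V} → Φ.Walk v w → List E
  | _, _, nil _ => []
  | _, _, cons e _ _ p => e :: p.edges

/-- The vertices of a walk, in order, including both ends. -/
def support : {v w : V} → Φ.Walk v w → List V
  | v, _, nil _ => [v]
  | v, _, cons _ _ _ p => v :: p.support

/-- The gain of a walk is the product of the gains of its edges in the direction of the walk. -/
def gain : {v w : V} → Φ.Walk v w → G
  | _, _, nil _ => 1
  | _, _, cons _ g _ p => g * p.gain

/-- A closed walk of positive length that repeats no edge, and no vertex except that it returns to
its start: it goes once around a circle.  Loops are circles of length 1. -/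
def IsCircle {v : V} (p : Φ.Walk v v) : Prop :=
  p.edges ≠ [] ∧ p.edges.Nodup ∧ p.support.tail.Nodup

def append : {v w x : V} → Φ.Walk v w → Φ.Walk w x → Φ.Walk v x
  | _, _, _, nil _, q => q
  | _, _, _, cons e g h p, q => cons e g h (p.append q)

theorem edges_append {v w x : V} (p : Φ.Walk v w) (q : Φ.Walk w x) :
    (p.append q).edges = p.edges ++ q.edges := by
  induction p with
  | nil => rfl
  | cons e g h p ih => simp [append, edges, ih]

theorem gain_append {v w x : V} (p : Φ.Walk v w) (q : Φ.Walk w x) :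
    (p.append q).gain = p.gain * q.gain := by
  induction p with
  | nil => simp [append, gain]
  | cons e g h p ih => simp [append, gain, ih, mul_assoc]

theorem mem_support_start {v w : V} (p : Φ.Walk v w) : v ∈ p.support := by
  cases p <;> simp [support]

theorem mem_support_end {v w : V} (p : Φ.Walk v w) : w ∈ p.support := by
  induction p with
  | nil => simp [support]
  | cons e g h p ih => simp [support, ih]

end Walk

variable {Φ}

theorem Step.symm {e : E} {v w : V} {g : G} (h : Φ.Step e v w g) : Φ.Step e w v g⁻¹ := by
  cases h with
  | fwd h => exact .bwd h
  | bwd h => simpa using Step.fwd h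

theorem Walk.exists_reverse {v w : V} (p : Φ.Walk v w) :
    ∃ q : Φ.Walk w v, (∀ e ∈ q.edges, e ∈ p.edges) ∧ q.gain = p.gain⁻¹ := by
  induction p with
  | nil v => exact ⟨.nil v, by simp [Walk.edges], by simp [Walk.gain]⟩
  | cons e g h p ih =>
    obtain ⟨q, hq, hg⟩ := ih
    refine ⟨q.append (.cons e g⁻¹ h.symm (.nil _)), ?_, ?_⟩
    · intro f hf
      simp only [Walk.edges_append, Walk.edges, List.mem_append, List.mem_cons,
        List.not_mem_nil, or_false] at hf ⊢
      exact hf.elim (fun h => .inr (hq f h)) .inl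
    · simp [Walk.gain_append, Walk.gain, hg]

variable (Φ)

/-- `v` and `w` are joined by a walk in the edge set `S`. -/
def Conn (S : Set E) (v w : V) : Prop := ∃ p : Φ.Walk v w, ∀ e ∈ p.edges, e ∈ S

/-- An edge set is balanced if it has no half edge and every circle in it has gain `1`. -/
def Balanced (S : Set E) : Prop :=
  (∀ e ∈ S, ¬ Φ.IsHalf e) ∧
    ∀ (v : V) (p : Φ.Walk v v), p.IsCircle → (∀ e ∈ p.edges, e ∈ S) → p.gain = 1

/-- A spanning forest, as an edge set: it has only loops and links and contains no circle. -/
def IsForest (F : Set E) : Prop :=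
  (∀ e ∈ F, ¬ Φ.IsHalf e ∧ ¬ Φ.IsLoose e) ∧
    ∀ (v : V) (p : Φ.Walk v v), p.IsCircle → ¬ ∀ e ∈ p.edges, e ∈ F

/-- The edges of `S` induced by `W`: they have an endpoint in `W` and none outside `W`. -/
def induce (S : Set E) (W : Set V) : Set E :=
  {e ∈ S | (Φ.ends e).Nonempty ∧ Φ.ends e ⊆ W}

/-- `η` is a switching function for `S`: switching by `η` turns the gain `g` of an edge from `v` to
`w` into `(η v)⁻¹ * g * η w`, and this is `1` for all edges in `S`. -/
def IsSwitchingFor (S : Set E) (η : V → G) : Prop :=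
  ∀ e ∈ S, ∀ v w g, Φ.edge e = .arc v w g → (η v)⁻¹ * g * η w = 1

variable {Φ}

theorem Conn.refl {S : Set E} (v : V) : Φ.Conn S v v := ⟨.nil v, by simp [Walk.edges]⟩

theorem Conn.symm {S : Set E} {v w : V} (h : Φ.Conn S v w) : Φ.Conn S w v := by
  obtain ⟨p, hp⟩ := h
  obtain ⟨q, hq, -⟩ := p.exists_reverse
  exact ⟨q, fun e he => hp e (hq e he)⟩

theorem Conn.trans {S : Set E} {v w x : V} (h : Φ.Conn S v w) (h' : Φ.Conn S w x) :
    Φ.Conn S v x := by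
  obtain ⟨p, hp⟩ := h
  obtain ⟨q, hq⟩ := h'
  refine ⟨p.append q, fun e he => ?_⟩
  rw [Walk.edges_append, List.mem_append] at he
  exact he.elim (hp e) (hq e)

theorem Conn.step {S : Set E} {e : E} {v w : V} {g : G} (he : e ∈ S) (h : Φ.Step e v w g) :
    Φ.Conn S v w := ⟨.cons e g h (.nil w), by simpa [Walk.edges] using he⟩

/-- Induction along a walk. -/
theorem Conn.rec_step {S : Set E} {r : V → V → Prop} (hr : ∀ v, r v v)
    (ht : ∀ u v w, r u v → r v w → r u w)
    (hs : ∀ e ∈ S, ∀ v w g, Φ.Step e v w g → r v w) {v w : V} (h : Φ.Conn S v w) : r v w := by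
  obtain ⟨p, hp⟩ := h
  induction p with
  | nil v => exact hr v
  | cons e g h p ih =>
    simp only [Walk.edges, List.mem_cons, forall_eq_or_imp] at hp
    exact ht _ _ _ (hs e hp.1 _ _ g h) (ih hp.2)

theorem Conn.mono {S T : Set E} (hST : S ⊆ T) {v w : V} (h : Φ.Conn S v w) : Φ.Conn T v w :=
  let ⟨p, hp⟩ := h
  ⟨p, fun e he => hST (hp e he)⟩

theorem conn_union_iff {S T : Set E} (h : ∀ e ∈ T, ∀ v w g, Φ.Step e v w g → Φ.Conn S v w)
    {v w : V} : Φ.Conn (S ∪ T) v w ↔ Φ.Conn S v w := by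
  refine ⟨fun hc => ?_, Conn.mono Set.subset_union_left⟩
  refine Conn.rec_step (r := Φ.Conn S) Conn.refl (fun _ _ _ => Conn.trans) ?_ hc
  rintro e (he | he) v w g hst
  · exact Conn.step he hst
  · exact h e he v w g hst

theorem mem_induce_of_step {S : Set E} {W : Set V} {e : E} {v w : V} {g : G} (he : e ∈ S)
    (h : Φ.Step e v w g) (hv : v ∈ W) (hw : w ∈ W) : e ∈ Φ.induce S W := by
  cases h with
  | fwd h => simp [induce, ends, h, he, hv, hw, Set.insert_subset_iff]
  | bwd h => simp [induce, ends, h, he, hv, hw, Set.insert_subset_iff]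

/-! ### Balance and switching functions -/

theorem IsSwitchingFor.step {S : Set E} {η : V → G} (hη : Φ.IsSwitchingFor S η) {e : E}
    (he : e ∈ S) {v w : V} {g : G} (h : Φ.Step e v w g) : g * η w = η v := by
  cases h with
  | fwd h =>
    have := hη e he _ _ _ h
    rw [mul_assoc, inv_mul_eq_one] at this
    exact this.symm
  | bwd h =>
    have := hη e he _ _ _ h
    rw [mul_assoc, inv_mul_eq_one] at this
    rw [this]; simp

theorem IsSwitchingFor.walk {S : Set E} {η : V → G} (hη : Φ.IsSwitchingFor S η) {v w : V}
    (p : Φ.Walk v w) (hp : ∀ e ∈ p.edges, e ∈ S) : p.gain * η w = η v := by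
  induction p with
  | nil v => simp [Walk.gain]
  | cons e g h p ih =>
    simp only [Walk.edges, List.mem_cons, forall_eq_or_imp] at hp
    rw [Walk.gain, mul_assoc, ih hp.2, hη.step hp.1 h]

theorem Walk.exists_split {v w : V} (q : Φ.Walk v w) {x : V} (hx : x ∈ q.support) :
    ∃ (a : Φ.Walk v x) (b : Φ.Walk x w), q.gain = a.gain * b.gain ∧ q.edges = a.edges ++ b.edges ∧
      a.support.Sublist q.support ∧ b.support.Sublist q.support := by
  induction q with
  | nil v =>
    simp only [Walk.support, List.mem_singleton] at hx
    subst hx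
    exact ⟨.nil _, .nil _, by simp [Walk.gain], by simp [Walk.edges], by simp, by simp⟩
  | @cons v u w e g h p ih =>
    by_cases hxv : x = v
    · subst hxv
      refine ⟨.nil _, .cons e g h p, by simp [Walk.gain], by simp [Walk.edges], ?_, by simp⟩
      simp [Walk.support]
    · simp only [Walk.support, List.mem_cons, hxv, false_or] at hx
      obtain ⟨a, b, h1, h2, h3, h4⟩ := ih hx
      refine ⟨.cons e g h a, b, by simp [Walk.gain, h1, mul_assoc], by simp [Walk.edges, h2],
        ?_, ?_⟩
      · simpa [Walk.support] using h3
      · simpa [Walk.support] using h4.trans (List.sublist_cons_self _ _)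

theorem Step.eq_or {e : E} {v w x y : V} {g k : G} (h : Φ.Step e v w g) (h' : Φ.Step e x y k) :
    (x = v ∧ y = w ∧ k = g) ∨ (x = w ∧ y = v ∧ k = g⁻¹) := by
  cases h with
  | fwd h => cases h' with
    | fwd h' => simp_all
    | bwd h' => simp_all
  | bwd h => cases h' with
    | fwd h' => simp_all
    | bwd h' => simp_all

theorem Walk.mem_support_of_step {v w : V} (q : Φ.Walk v w) {e : E} (he : e ∈ q.edges)
    {x y : V} {k : G} (h : Φ.Step e x y k) : x ∈ q.support := by
  induction q with
  | nil => simp [Walk.edges] at he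
  | cons e' g h' p ih =>
    simp only [Walk.edges, List.mem_cons] at he
    simp only [Walk.support, List.mem_cons]
    rcases he with rfl | he
    · rcases h'.eq_or h with ⟨rfl, -, -⟩ | ⟨rfl, -, -⟩
      · exact .inl rfl
      · exact .inr p.mem_support_start
    · exact .inr (ih he)

theorem Walk.edges_nodup {v w : V} (q : Φ.Walk v w) (hq : q.support.Nodup) : q.edges.Nodup := by
  induction q with
  | nil => simp [Walk.edges]
  | cons e g h p ih =>
    simp only [Walk.support, List.nodup_cons] at hq
    simp only [Walk.edges, List.nodup_cons]
    exact ⟨fun he => hq.1 (p.mem_support_of_step he h), ih hq.2⟩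

theorem Walk.eq_nil_of_nodup {v : V} (q : Φ.Walk v v) (hq : q.support.Nodup) : q = .nil v := by
  cases q with
  | nil => rfl
  | cons e g h p =>
    simp only [Walk.support, List.nodup_cons] at hq
    exact absurd p.mem_support_end hq.1

theorem Walk.gain_of_edge_mem {v w : V} (q : Φ.Walk w v) (hq : q.support.Nodup) {e : E} {g : G}
    (he : e ∈ q.edges) (h : Φ.Step e v w g) : q.gain = g⁻¹ := by
  cases q with
  | nil => simp [Walk.edges] at he
  | cons e' k h' p =>
    simp only [Walk.support, List.nodup_cons] at hq
    simp only [Walk.edges, List.mem_cons] at he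
    rcases he with rfl | he
    · rcases h.symm.eq_or h' with ⟨-, rfl, rfl⟩ | ⟨-, rfl, -⟩
      · rw [p.eq_nil_of_nodup hq.2]; simp [Walk.gain]
      · exact absurd p.mem_support_start hq.1
    · exact absurd (p.mem_support_of_step he h.symm) hq.1

theorem Balanced.exists_path {S : Set E} (hS : Φ.Balanced S) {v w : V} (p : Φ.Walk v w)
    (hp : ∀ e ∈ p.edges, e ∈ S) :
    ∃ q : Φ.Walk v w, q.support.Nodup ∧ (∀ e ∈ q.edges, e ∈ S) ∧ q.gain = p.gain := by
  induction p with
  | nil v => exact ⟨.nil v, by simp [Walk.support], hp, rfl⟩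
  | @cons v u w e g h p ih =>
    simp only [Walk.edges, List.mem_cons, forall_eq_or_imp] at hp
    obtain ⟨q, hq, hqS, hqg⟩ := ih hp.2
    by_cases hv : v ∈ q.support
    · obtain ⟨a, b, h1, h2, h3, h4⟩ := q.exists_split hv
      have haS : ∀ e ∈ a.edges, e ∈ S := fun e he => hqS e (by simp [h2, he])
      have hbS : ∀ e ∈ b.edges, e ∈ S := fun e he => hqS e (by simp [h2, he])
      have ha := hq.sublist h3
      refine ⟨b, hq.sublist h4, hbS, ?_⟩
      have key : g * a.gain = 1 := by
        by_cases hea : e ∈ a.edges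
        · rw [a.gain_of_edge_mem ha hea h]; simp
        · refine hS.2 v (.cons e g h a) ⟨by simp [Walk.edges], ?_, ?_⟩ ?_
          · simp only [Walk.edges, List.nodup_cons]
            exact ⟨hea, a.edges_nodup ha⟩
          · simpa [Walk.support] using ha
          · simp only [Walk.edges, List.mem_cons, forall_eq_or_imp]
            exact ⟨hp.1, haS⟩
      rw [Walk.gain, ← hqg, h1, ← mul_assoc, key, one_mul]
    · refine ⟨.cons e g h q, ?_, ?_, by simp [Walk.gain, hqg]⟩
      · simpa [Walk.support] using ⟨hv, hq⟩
      · simp only [Walk.edges, List.mem_cons, forall_eq_or_imp]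
        exact ⟨hp.1, hqS⟩

theorem Balanced.gain_closed {S : Set E} (hS : Φ.Balanced S) {v : V} (p : Φ.Walk v v)
    (hp : ∀ e ∈ p.edges, e ∈ S) : p.gain = 1 := by
  obtain ⟨q, hq, -, hg⟩ := hS.exists_path p hp
  rw [← hg, q.eq_nil_of_nodup hq, Walk.gain]

/-- A balanced edge set has a switching function. -/
theorem Balanced.exists_switching {S : Set E} (hS : Φ.Balanced S) :
    ∃ η : V → G, Φ.IsSwitchingFor S η := by
  let s : Setoid V := ⟨Φ.Conn S, ⟨Conn.refl, Conn.symm, Conn.trans⟩⟩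
  have hr : ∀ v, Φ.Conn S v (Quotient.mk s v).out := fun v => (Quotient.mk_out (s := s) v).symm
  choose p hp using hr
  refine ⟨fun v => (p v).gain, fun e he v w g hvw => ?_⟩
  have hst : Φ.Step e v w g := .fwd hvw
  have hout : (Quotient.mk s v) = (Quotient.mk s w) := Quotient.sound (Conn.step he hst)
  have aux : ∀ x (hx : (Quotient.mk s v).out = x) (q : Φ.Walk w x), (∀ e ∈ q.edges, e ∈ S) →
      g * q.gain = (p v).gain := by
    rintro x rfl q hq
    obtain ⟨r, hr, hrg⟩ := (p v).exists_reverse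
    have := hS.gain_closed ((Walk.cons e g hst q).append r) (by
      intro f hf
      simp only [Walk.edges_append, Walk.edges, List.mem_append, List.mem_cons] at hf
      rcases hf with (rfl | hf) | hf
      · exact he
      · exact hq f hf
      · exact hp v f (hr f hf))
    rw [Walk.gain_append, Walk.gain, hrg, mul_inv_eq_one] at this
    exact this
  rw [mul_assoc, aux _ (by rw [hout]) (p w) (hp w)]
  simp

theorem balanced_iff {S : Set E} :
    Φ.Balanced S ↔ (∀ e ∈ S, ¬ Φ.IsHalf e) ∧ ∃ η : V → G, Φ.IsSwitchingFor S η := by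
  refine ⟨fun h => ⟨h.1, h.exists_switching⟩, ?_⟩
  rintro ⟨h, η, hη⟩
  refine ⟨h, fun v p _ hp => ?_⟩
  simpa using hη.walk p hp

theorem Balanced.mono {S T : Set E} (hT : Φ.Balanced T) (h : S ⊆ T) : Φ.Balanced S :=
  ⟨fun e he => hT.1 e (h he), fun v p hp hS => hT.2 v p hp fun e he => h (hS e he)⟩

theorem balanced_empty : Φ.Balanced ∅ :=
  balanced_iff.2 ⟨by simp, fun _ => 1, by simp [IsSwitchingFor]⟩

/-- Edges that close up balanced circles with a balanced set `S` may be added to it together. -/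
theorem Balanced.union {S T : Set E} (hS : Φ.Balanced S)
    (hc : ∀ e ∈ T, ∀ v w g, Φ.Step e v w g → Φ.Conn S v w)
    (hT : ∀ e ∈ T, Φ.Balanced (insert e S)) : Φ.Balanced (S ∪ T) := by
  obtain ⟨hh, η, hη⟩ := balanced_iff.1 hS
  refine balanced_iff.2 ⟨?_, η, ?_⟩
  · rintro e (he | he)
    · exact hh e he
    · exact (hT e he).1 e (by simp)
  · rintro e (he | he) v w g hvw
    · exact hη e he v w g hvw
    · obtain ⟨-, η', hη'⟩ := balanced_iff.1 (hT e he)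
      obtain ⟨p, hp⟩ := hc e he v w g (.fwd hvw)
      have h1 := hη.walk p hp
      have h2 := hη'.walk p fun f hf => Set.mem_insert_of_mem _ (hp f hf)
      have h3 := hη'.step (Set.mem_insert e S) (.fwd hvw)
      have h4 : g = p.gain := mul_right_cancel (h3.trans h2.symm)
      rw [mul_assoc, h4, h1]; simp

/-- Adding an edge between different components of a balanced set keeps it balanced. -/
theorem Balanced.insert_bridge {S : Set E} (hS : Φ.Balanced S) {e : E} {v w : V} {g : G}
    (he : Φ.Step e v w g) (hvw : ¬ Φ.Conn S v w) : Φ.Balanced (insert e S) := by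
  classical
  obtain ⟨hh, η, hη⟩ := balanced_iff.1 hS
  have hnh : ¬ Φ.IsHalf e := by
    rintro ⟨x, hx⟩
    cases he <;> simp_all
  let η' : V → G := fun x => if Φ.Conn S w x then η x * ((η w)⁻¹ * g⁻¹ * η v) else η x
  have h1 : g * η' w = η' v := by
    have hwv : ¬ Φ.Conn S w v := fun h => hvw h.symm
    simp [η', hwv, Conn.refl, mul_assoc]
  refine balanced_iff.2 ⟨?_, η', ?_⟩
  · rintro f (rfl | hf)
    · exact hnh
    · exact hh f hf
  · rintro f (rfl | hf) x y k hxy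
    · rcases he.eq_or (.fwd hxy) with ⟨rfl, rfl, rfl⟩ | ⟨rfl, rfl, rfl⟩
      · rw [mul_assoc, h1]; simp
      · rw [← h1]; simp
    · have hst : Φ.Step f x y k := .fwd hxy
      have h2 := hη.step hf hst
      have h3 : Φ.Conn S w x ↔ Φ.Conn S w y :=
        ⟨fun h => h.trans (Conn.step hf hst), fun h => h.trans (Conn.step hf hst).symm⟩
      have h4 : k * η' y = η' x := by
        by_cases h : Φ.Conn S w y
        · simp only [η', h, h3.2 h, if_true]
          rw [← mul_assoc, h2]
        · have h' : ¬ Φ.Conn S w x := fun hx => h (h3.1 hx)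
          simp only [η', h, h', if_false]
          exact h2
      rw [mul_assoc, h4]; simp

end Basic

noncomputable section Rank

variable {V E G : Type*} [Group G] [Fintype V] (Φ : GainGraph V E G)

open Classical in
/-- The vertex set of the component of `(V, S)` that contains `v`. -/
def comp (S : Set E) (v : V) : Finset V := Finset.univ.filter fun w => Φ.Conn S v w

open Classical in
/-- The partition `π(S)` of `V` into the vertex sets of the components of `(V, S)`. -/
def parts (S : Set E) : Finset (Finset V) := Finset.univ.image (Φ.comp S)

open Classical in
/-- `π_b(S)`: the vertex sets `W` of the components of `(V, S)` for which `S:W` is balanced. -/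
def balParts (S : Set E) : Finset (Finset V) :=
  (Φ.parts S).filter fun W => Φ.Balanced (Φ.induce S (W : Set V))

/-- The number `c(S)` of components of `(V, S)`; loose edges are not counted. -/
def numComp (S : Set E) : ℕ := (Φ.parts S).card

/-- The number `b(S)` of balanced components of `(V, S)`. -/
def numBal (S : Set E) : ℕ := (Φ.balParts S).card

open Classical in
/-- The rank function of the complete lift matroid, on the ground set `E ∪ {e₀}`, which is
`Option E` with `e₀ = none`: the rank of `S ⊆ E` is `n - c(S)` if `S` is balanced and
`n - c(S) + 1` if not, and the rank of `S ∪ {e₀}` is `n - c(S) + 1`. -/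
def liftRank (X : Set (Option E)) : ℕ :=
  (Fintype.card V - Φ.numComp (some ⁻¹' X)) +
    if none ∈ X ∨ ¬ Φ.Balanced (some ⁻¹' X) then 1 else 0

variable {Φ}

theorem mem_comp {S : Set E} {v w : V} : w ∈ Φ.comp S v ↔ Φ.Conn S v w := by
  simp [comp]

theorem comp_eq_iff {S : Set E} {v w : V} : Φ.comp S v = Φ.comp S w ↔ Φ.Conn S v w := by
  constructor
  · intro h
    rw [← mem_comp, h, mem_comp]
    exact Conn.refl w
  · intro h
    ext x
    rw [mem_comp, mem_comp]
    exact ⟨fun hx => h.symm.trans hx, fun hx => h.trans hx⟩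

theorem mem_parts {S : Set E} {W : Finset V} : W ∈ Φ.parts S ↔ ∃ v, Φ.comp S v = W := by
  simp [parts]

theorem mem_comp_self (S : Set E) (v : V) : v ∈ Φ.comp S v := mem_comp.2 (Conn.refl v)

theorem parts_nonempty {S : Set E} {W : Finset V} (h : W ∈ Φ.parts S) : W.Nonempty := by
  obtain ⟨v, rfl⟩ := mem_parts.1 h
  exact ⟨v, mem_comp_self S v⟩

theorem comp_eq_of_mem_parts {S : Set E} {W : Finset V} (hW : W ∈ Φ.parts S) {v : V} (hv : v ∈ W) :
    Φ.comp S v = W := by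
  obtain ⟨w, rfl⟩ := mem_parts.1 hW
  exact (comp_eq_iff.2 (mem_comp.1 hv)).symm

theorem mem_balParts {S : Set E} {W : Finset V} :
    W ∈ Φ.balParts S ↔ W ∈ Φ.parts S ∧ Φ.Balanced (Φ.induce S (W : Set V)) := by
  simp [balParts]

theorem balParts_nonempty {S : Set E} {W : Finset V} (h : W ∈ Φ.balParts S) : W.Nonempty :=
  parts_nonempty (mem_balParts.1 h).1

theorem numComp_le (S : Set E) : Φ.numComp S ≤ Fintype.card V := by
  classical
  exact Finset.card_image_le

theorem parts_union {S T : Set E} (h : ∀ e ∈ T, ∀ v w g, Φ.Step e v w g → Φ.Conn S v w) :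
    Φ.parts (S ∪ T) = Φ.parts S := by
  have : Φ.comp (S ∪ T) = Φ.comp S := by
    ext v w
    rw [mem_comp, mem_comp, conn_union_iff h]
  rw [parts, parts, this]

theorem numComp_insert_of_conn {S : Set E} {e : E}
    (h : ∀ v w g, Φ.Step e v w g → Φ.Conn S v w) : Φ.numComp (insert e S) = Φ.numComp S := by
  rw [Set.insert_eq, Set.union_comm, numComp, numComp, parts_union]
  rintro f rfl
  exact h

theorem numComp_insert_of_not_conn {S : Set E} {e : E} {v w : V} {g : G} (he : Φ.Step e v w g)
    (hvw : ¬ Φ.Conn S v w) : Φ.numComp S = Φ.numComp (insert e S) + 1 := by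
  classical
  set A := Φ.comp S v with hA
  set B := Φ.comp S w with hB
  have hAB : A ≠ B := fun h => hvw (comp_eq_iff.1 h)
  have hconn : ∀ x y, Φ.Conn (insert e S) x y ↔
      Φ.Conn S x y ∨ (x ∈ A ∪ B ∧ y ∈ A ∪ B) := by
    have hmono : ∀ {x y}, Φ.Conn S x y → Φ.Conn (insert e S) x y :=
      fun h => Conn.mono (Set.subset_insert e S) h
    have hcl : ∀ {x y}, Φ.Conn S x y → (x ∈ A ∪ B ↔ y ∈ A ∪ B) := by
      intro x y h
      simp only [Finset.mem_union, hA, hB, mem_comp]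
      exact ⟨fun k => k.imp (fun k => k.trans h) (fun k => k.trans h),
        fun k => k.imp (fun k => k.trans h.symm) (fun k => k.trans h.symm)⟩
    intro x y
    constructor
    · refine Conn.rec_step (r := fun x y => Φ.Conn S x y ∨ (x ∈ A ∪ B ∧ y ∈ A ∪ B))
        (fun v => .inl (Conn.refl v)) ?_ ?_
      · rintro a b c (h | h) (k | k)
        · exact .inl (h.trans k)
        · exact .inr ⟨(hcl h).2 k.1, k.2⟩
        · exact .inr ⟨h.1, (hcl k).1 h.2⟩
        · exact .inr ⟨h.1, k.2⟩
      · rintro f (rfl | hf) a b k hst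
        · have hv : v ∈ A ∪ B := Finset.mem_union_left _ (mem_comp_self S v)
          have hw : w ∈ A ∪ B := Finset.mem_union_right _ (mem_comp_self S w)
          rcases he.eq_or hst with ⟨rfl, rfl, -⟩ | ⟨rfl, rfl, -⟩
          · exact .inr ⟨hv, hw⟩
          · exact .inr ⟨hw, hv⟩
        · exact .inl (Conn.step hf hst)
    · rintro (h | ⟨h, k⟩)
      · exact hmono h
      · have hv : ∀ z ∈ A ∪ B, Φ.Conn (insert e S) v z := by
          intro z hz
          simp only [Finset.mem_union, hA, hB, mem_comp] at hz
          rcases hz with hz | hz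
          · exact hmono hz
          · exact (Conn.step (Set.mem_insert e S) he).trans (hmono hz)
        exact (hv x h).symm.trans (hv y k)
  have hparts : Φ.parts (insert e S) = insert (A ∪ B) (((Φ.parts S).erase A).erase B) := by
    ext W
    simp only [Finset.mem_insert, Finset.mem_erase, mem_parts]
    constructor
    · rintro ⟨x, rfl⟩
      by_cases hx : x ∈ A ∪ B
      · left
        ext y
        rw [mem_comp, hconn]
        refine ⟨?_, fun hy => .inr ⟨hx, hy⟩⟩
        rintro (h | h)
        · simp only [Finset.mem_union, hA, hB, mem_comp] at hx ⊢
          exact hx.imp (fun k => k.trans h) (fun k => k.trans h)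
        · exact h.2
      · right
        have hcx : Φ.comp (insert e S) x = Φ.comp S x := by
          ext y
          rw [mem_comp, mem_comp, hconn]
          simp [hx]
        rw [hcx]
        refine ⟨fun h => hx ?_, fun h => hx ?_, x, rfl⟩
        · exact Finset.mem_union_right _ (h ▸ mem_comp_self S x)
        · exact Finset.mem_union_left _ (h ▸ mem_comp_self S x)
    · rintro (rfl | ⟨hWB, hWA, x, rfl⟩)
      · refine ⟨v, ?_⟩
        ext y
        rw [mem_comp, hconn]
        constructor
        · rintro (h | h)
          · exact Finset.mem_union_left _ (mem_comp.2 h)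
          · exact h.2
        · exact fun h => .inr ⟨Finset.mem_union_left _ (mem_comp_self S v), h⟩
      · refine ⟨x, ?_⟩
        have hx : x ∉ A ∪ B := by
          simp only [Finset.mem_union, hA, hB, mem_comp, not_or]
          exact ⟨fun h => hWA (comp_eq_iff.2 h.symm), fun h => hWB (comp_eq_iff.2 h.symm)⟩
        ext y
        rw [mem_comp, mem_comp, hconn]
        simp [hx]
  have hAm : A ∈ Φ.parts S := mem_parts.2 ⟨v, rfl⟩
  have hBm : B ∈ (Φ.parts S).erase A := Finset.mem_erase.2 ⟨hAB.symm, mem_parts.2 ⟨w, rfl⟩⟩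
  have hnot : A ∪ B ∉ ((Φ.parts S).erase A).erase B := by
    intro h
    obtain ⟨-, hne, hm⟩ := by simpa only [Finset.mem_erase] using h
    obtain ⟨x, hx⟩ := mem_parts.1 hm
    apply hne
    have hvx : v ∈ Φ.comp S x := hx ▸ Finset.mem_union_left _ (mem_comp_self S v)
    rw [← hx, hA, comp_eq_iff]
    exact mem_comp.1 hvx
  rw [numComp, numComp, hparts, Finset.card_insert_of_notMem hnot, ← Finset.card_erase_add_one hAm,
    ← Finset.card_erase_add_one hBm]

/-- Adding a point raises the rank by 0 or 1. -/
theorem liftRank_insert (X : Set (Option E)) (x : Option E) :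
    Φ.liftRank X ≤ Φ.liftRank (insert x X) ∧ Φ.liftRank (insert x X) ≤ Φ.liftRank X + 1 := by
  cases x with
  | none =>
    have : some ⁻¹' (insert none X) = some ⁻¹' X := by ext; simp
    rw [liftRank, liftRank, this]
    simp only [Set.mem_insert_iff, true_or, if_true]
    split_ifs <;> omega
  | some e =>
    have h1 : some ⁻¹' (insert (some e) X) = insert e (some ⁻¹' X) := by ext; simp
    have h2 : none ∈ insert (some e) X ↔ none ∈ X := by simp
    rw [liftRank, liftRank, h1, h2]
    by_cases h : ∀ v w g, Φ.Step e v w g → Φ.Conn (some ⁻¹' X) v w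
    · rw [numComp_insert_of_conn h]
      have h3 : none ∈ X ∨ ¬ Φ.Balanced (some ⁻¹' X) →
          none ∈ X ∨ ¬ Φ.Balanced (insert e (some ⁻¹' X)) :=
        Or.imp_right fun h hb => h (hb.mono (Set.subset_insert _ _))
      split_ifs <;> first | omega | tauto
    · push Not at h
      obtain ⟨v, w, g, hst, hvw⟩ := h
      have h3 : Φ.Balanced (insert e (some ⁻¹' X)) ↔ Φ.Balanced (some ⁻¹' X) :=
        ⟨fun hb => hb.mono (Set.subset_insert _ _), fun hb => hb.insert_bridge hst hvw⟩
      have h4 := numComp_insert_of_not_conn hst hvw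
      have h5 := Φ.numComp_le (some ⁻¹' X)
      rw [h3]
      omega

/-- If no single point of `Y` raises the rank of `X`, then `Y` does not. -/
theorem liftRank_union {X Y : Set (Option E)}
    (h : ∀ x ∈ Y, Φ.liftRank (insert x X) = Φ.liftRank X) :
    Φ.liftRank (X ∪ Y) = Φ.liftRank X := by
  have hins : ∀ e : E, some ⁻¹' (insert (some e) X) = insert e (some ⁻¹' X) := by
    intro e; ext; simp
  have hcon : ∀ e ∈ some ⁻¹' Y, ∀ v w g, Φ.Step e v w g → Φ.Conn (some ⁻¹' X) v w := by
    intro e he v w g hst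
    by_contra hvw
    have h1 := h _ he
    rw [liftRank, liftRank, hins] at h1
    have h3 : Φ.Balanced (insert e (some ⁻¹' X)) ↔ Φ.Balanced (some ⁻¹' X) :=
      ⟨fun hb => hb.mono (Set.subset_insert _ _), fun hb => hb.insert_bridge hst hvw⟩
    have h2 : none ∈ insert (some e) X ↔ none ∈ X := by simp
    have h4 := numComp_insert_of_not_conn hst hvw
    have h5 := Φ.numComp_le (some ⁻¹' X)
    rw [h3, h2] at h1
    omega
  have hnum : Φ.numComp (some ⁻¹' (X ∪ Y)) = Φ.numComp (some ⁻¹' X) := by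
    rw [Set.preimage_union, numComp, numComp, parts_union hcon]
  have hind : (none ∈ X ∪ Y ∨ ¬ Φ.Balanced (some ⁻¹' (X ∪ Y))) ↔
      (none ∈ X ∨ ¬ Φ.Balanced (some ⁻¹' X)) := by
    constructor
    · intro h1
      by_contra h2
      push Not at h2
      obtain ⟨hn, hb⟩ := h2
      have hnY : none ∉ Y := by
        intro hY
        have h3 := h _ hY
        have : some ⁻¹' (insert none X) = some ⁻¹' X := by ext; simp
        rw [liftRank, liftRank, this] at h3
        simp [hn, hb] at h3
      have hbY : ∀ e ∈ some ⁻¹' Y, Φ.Balanced (insert e (some ⁻¹' X)) := by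
        intro e he
        by_contra hbe
        have h3 := h _ he
        rw [liftRank, liftRank, hins, numComp_insert_of_conn (hcon e he)] at h3
        simp [hn, hb, hbe] at h3
      rcases h1 with h1 | h1
      · exact h1.elim hn hnY
      · exact h1 (by rw [Set.preimage_union]; exact hb.union hcon hbY)
    · rintro (h1 | h1)
      · exact .inl (.inl h1)
      · refine .inr fun hb => h1 (hb.mono ?_)
        rw [Set.preimage_union]
        exact Set.subset_union_left
  unfold liftRank
  rw [hnum]
  congr 1
  split_ifs <;> tauto

theorem liftRank_empty : Φ.liftRank ∅ = 0 := by
  have hn : Φ.numComp ∅ = Fintype.card V := by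
    classical
    rw [numComp, parts, Finset.card_image_of_injective, Finset.card_univ]
    intro v w h
    rw [comp_eq_iff] at h
    exact Conn.rec_step (r := Eq) (fun _ => rfl) (fun _ _ _ => Eq.trans) (by simp) h
  simp [liftRank, hn, balanced_empty]

theorem liftRank_union_le [Finite E] (X Y : Set (Option E)) :
    Φ.liftRank X ≤ Φ.liftRank (X ∪ Y) ∧ Φ.liftRank (X ∪ Y) ≤ Φ.liftRank X + Y.ncard := by
  induction Y, Set.toFinite Y using Set.Finite.induction_on with
  | empty => simp
  | @insert a Y ha hY ih =>
    rw [Set.union_insert, Set.ncard_insert_of_notMem ha hY]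
    have := Φ.liftRank_insert (X ∪ Y) a
    omega

theorem liftRank_mono [Finite E] {X Y : Set (Option E)} (h : X ⊆ Y) :
    Φ.liftRank X ≤ Φ.liftRank Y := by
  have := (Φ.liftRank_union_le X Y).1
  rwa [Set.union_eq_self_of_subset_left h] at this

theorem liftRank_le_ncard [Finite E] (X : Set (Option E)) : Φ.liftRank X ≤ X.ncard := by
  have := (Φ.liftRank_union_le ∅ X).2
  rwa [Set.empty_union, liftRank_empty, zero_add] at this

variable (Φ)

/-- The complete lift matroid: the matroid on `E ∪ {e₀}` with rank function `liftRank`. -/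
def liftMatroid [Finite E] : Matroid (Option E) :=
  (IndepMatroid.ofFinite (E := Set.univ) Set.finite_univ
    (fun X => Φ.liftRank X = X.ncard)
    (by simpa using Φ.liftRank_empty)
    (by
      intro I J hJ hIJ
      have h1 := (Φ.liftRank_union_le I (J \ I)).2
      rw [Set.union_sdiff_cancel hIJ, hJ] at h1
      have h2 := Set.ncard_sdiff_add_ncard_of_subset hIJ
      have h3 := Φ.liftRank_le_ncard I
      omega)
    (by
      intro I J hI hJ hlt
      by_contra hcon
      push Not at hcon
      have h1 : Φ.liftRank (I ∪ J) = Φ.liftRank I := by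
        refine liftRank_union fun x hx => ?_
        by_cases hxI : x ∈ I
        · rw [Set.insert_eq_of_mem hxI]
        · have h2 := hcon x hx hxI
          rw [Set.ncard_insert_of_notMem hxI] at h2
          have h3 := Φ.liftRank_insert I x
          omega
      have h4 := Φ.liftRank_mono (Set.subset_union_right (s := I) (t := J))
      omega)
    (fun _ _ => Set.subset_univ _)).matroid

variable {Φ}

theorem liftMatroid_indep_iff [Finite E] {X : Set (Option E)} :
    Φ.liftMatroid.Indep X ↔ Φ.liftRank X = X.ncard := by
  simp [liftMatroid]

theorem liftMatroid_ground [Finite E] : Φ.liftMatroid.E = Set.univ := rfl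

/-- `liftRank` is indeed the rank function of `liftMatroid`. -/
theorem liftMatroid_eRk [Finite E] (X : Set (Option E)) :
    Φ.liftMatroid.eRk X = Φ.liftRank X := by
  obtain ⟨B, hB⟩ := Φ.liftMatroid.exists_isBasis X (by simp [liftMatroid_ground])
  have hi := liftMatroid_indep_iff.1 hB.indep
  have h1 : Φ.liftRank (B ∪ X) = Φ.liftRank B := by
    refine liftRank_union fun x hx => ?_
    by_cases hxB : x ∈ B
    · rw [Set.insert_eq_of_mem hxB]
    · have h2 : ¬ Φ.liftMatroid.Indep (insert x B) := fun h =>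
        hxB (hB.mem_of_insert_indep hx h)
      rw [liftMatroid_indep_iff, Set.ncard_insert_of_notMem hxB] at h2
      have h3 := Φ.liftRank_insert B x
      omega
  rw [Set.union_eq_self_of_subset_left hB.subset] at h1
  rw [hB.eRk_eq_encard, h1, hi, (Set.toFinite B).cast_ncard_eq]

/-- The basepoint is not a loop of the complete lift matroid. -/
theorem liftMatroid_isNonloop_none [Finite E] : Φ.liftMatroid.IsNonloop none := by
  rw [← Matroid.indep_singleton, liftMatroid_indep_iff, Set.ncard_singleton]
  have h1 := Φ.liftRank_le_ncard {none}
  have h2 : 1 ≤ Φ.liftRank {none} := by simp [liftRank]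
  rw [Set.ncard_singleton] at h1
  omega

end Rank

end GainGraph

/-! ### Activity in a semimatroid

The semimatroid associated with a matroid `M₀` on `E ∪ {e₀}`, here `Option E` with `e₀ = none`,
consists of the balanced sets, i.e. the subsets of `E` whose closure does not contain `e₀`, with the
closures, circuits, independent sets of `M₀` restricted to them. -/

namespace Semimatroid

variable {E : Type*} (M₀ : Matroid (Option E))

/-- Balanced sets of the semimatroid. -/
def SemiBalanced (S : Set E) : Prop := none ∉ M₀.closure (some '' S)

/-- Independent sets of the semimatroid: the balanced independent sets of `M₀`. -/
def SemiIndep (F : Set E) : Prop := M₀.Indep (some '' F) ∧ SemiBalanced M₀ F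

/-- `e` is externally active with respect to the independent set `F`: it lies in the closure of `F`
but not in `F`, and it is the largest point of its fundamental circuit. -/
def ExternallyActive (O : LinearOrder E) (F : Set E) (e : E) : Prop :=
  SemiIndep M₀ F ∧ e ∉ F ∧ some e ∈ M₀.closure (some '' F) ∧
    ∀ f : E, some f ∈ M₀.fundCircuit (some e) (some '' F) → O.le f e

/-- The number `ε(F)` of externally active points. -/
noncomputable def numExtActive (O : LinearOrder E) (F : Set E) : ℕ :=
  {e | ExternallyActive M₀ O F e}.ncard

end Semimatroid

/-! ### Sums in a commutative semigroup -/

section NonemptySum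

variable {V K : Type*} [AddCommSemigroup K]

theorem Finset.coe_sum_ne_zero {s : Finset V} (hs : s.Nonempty) (f : V → K) :
    ∑ v ∈ s, (f v : WithZero K) ≠ 0 := by
  have : ∃ k : K, ∑ v ∈ s, (f v : WithZero K) = k := by
    induction hs using Finset.Nonempty.cons_induction with
    | singleton a => exact ⟨f a, by simp⟩
    | cons a s ha hs ih =>
      obtain ⟨k, hk⟩ := ih
      exact ⟨f a + k, by rw [Finset.sum_cons, hk, WithZero.coe_add]⟩
  obtain ⟨k, hk⟩ := this
  rw [hk]
  exact WithZero.coe_ne_zero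

/-- The sum of a nonempty finite family in a commutative semigroup (which need not have a zero). -/
def Finset.nonemptySum (s : Finset V) (hs : s.Nonempty) (f : V → K) : K :=
  WithZero.unzero (Finset.coe_sum_ne_zero hs f)

theorem Finset.coe_nonemptySum (s : Finset V) (hs : s.Nonempty) (f : V → K) :
    ((s.nonemptySum hs f : K) : WithZero K) = ∑ v ∈ s, (f v : WithZero K) :=
  WithZero.coe_unzero _

end NonemptySum

namespace GainGraph

noncomputable section Weights

variable {V E G : Type*} [Group G] [Lattice G] [Fintype V] (Φ : GainGraph V E G)

/-- `η` is, on the vertex sets `W` of the balanced components of `S`, the top switching function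
for `S`: it is a switching function for `S:W`, and the meet of its values on `W` is `1`. -/
def IsTopSwitching (S : Set E) (η : V → G) : Prop :=
  ∀ (W : Finset V) (hW : W ∈ Φ.balParts S),
    Φ.IsSwitchingFor (Φ.induce S (W : Set V)) η ∧ W.inf' (balParts_nonempty hW) η = 1

/-- Top switching functions exist. -/
theorem exists_isTopSwitching [MulLeftMono G] [MulRightMono G] (S : Set E) :
    ∃ η : V → G, Φ.IsTopSwitching S η := by
  classical
  have h : ∀ W : Finset V, ∃ η : V → G, Φ.Balanced (Φ.induce S (W : Set V)) →
      Φ.IsSwitchingFor (Φ.induce S (W : Set V)) η := by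
    intro W
    by_cases hb : Φ.Balanced (Φ.induce S (W : Set V))
    · obtain ⟨η, hη⟩ := hb.exists_switching
      exact ⟨η, fun _ => hη⟩
    · exact ⟨1, fun h => absurd h hb⟩
  choose η₀ hη₀ using h
  let η : V → G := fun v =>
    η₀ (Φ.comp S v) v * ((Φ.comp S v).inf' ⟨v, mem_comp_self S v⟩ (η₀ (Φ.comp S v)))⁻¹
  refine ⟨η, fun W hW => ?_⟩
  have hne := balParts_nonempty hW
  have hη : ∀ v ∈ W, η v = η₀ W v * (W.inf' hne (η₀ W))⁻¹ := by
    intro v hv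
    have hc := comp_eq_of_mem_parts (mem_balParts.1 hW).1 hv
    simp only [η]
    subst hc
    rfl
  constructor
  · intro e he v w g hvw
    have h1 := hη₀ W (mem_balParts.1 hW).2 e he v w g hvw
    have h2 : v ∈ W ∧ w ∈ W := by
      have h3 := he.2.2
      simpa [ends, hvw, Set.insert_subset_iff] using h3
    rw [hη v h2.1, hη w h2.2, mul_inv_rev, inv_inv]
    set c := W.inf' hne (η₀ W)
    calc c * (η₀ W v)⁻¹ * g * (η₀ W w * c⁻¹) = c * ((η₀ W v)⁻¹ * g * η₀ W w) * c⁻¹ := by group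
      _ = 1 := by rw [h1]; group
  · rw [Finset.inf'_congr hne rfl hη]
    have h4 := map_finset_inf' (OrderIso.mulRight (W.inf' hne (η₀ W))⁻¹) hne (η₀ W)
    have h5 : W.inf' hne (fun v => η₀ W v * (W.inf' hne (η₀ W))⁻¹) =
        W.inf' hne (η₀ W) * (W.inf' hne (η₀ W))⁻¹ := h4.symm
    rw [h5, mul_inv_cancel]

variable {Φ} in
/-- On the balanced components the top switching function is unique. -/
theorem IsTopSwitching.unique [MulLeftMono G] [MulRightMono G] {S : Set E} {η η' : V → G}
    (h : Φ.IsTopSwitching S η) (h' : Φ.IsTopSwitching S η') {W : Finset V}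
    (hW : W ∈ Φ.balParts S) {v : V} (hv : v ∈ W) : η v = η' v := by
  have hne := balParts_nonempty hW
  have key : ∀ w ∈ W, η' w = η w * ((η v)⁻¹ * η' v) := by
    intro w hw
    have hc := comp_eq_of_mem_parts (mem_balParts.1 hW).1 hv
    have hvw : Φ.Conn S v w := by rw [← mem_comp, hc]; exact hw
    have hr := Conn.rec_step (r := fun a b => a ∈ W → b ∈ W ∧ (η a)⁻¹ * η' a = (η b)⁻¹ * η' b)
      (fun a ha => ⟨ha, rfl⟩)
      (fun a b c hab hbc ha => ⟨(hbc (hab ha).1).1, (hab ha).2.trans (hbc (hab ha).1).2⟩)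
      (fun e he a b g hst ha => by
        have hcb : b ∈ W := by
          rw [← comp_eq_of_mem_parts (mem_balParts.1 hW).1 ha, mem_comp]
          exact Conn.step he hst
        refine ⟨hcb, ?_⟩
        have hi := mem_induce_of_step (W := (W : Set V)) he hst ha hcb
        rw [← (h W hW).1.step hi hst, ← (h' W hW).1.step hi hst]
        group) hvw
    rw [(hr hv).2]; group
  have h1 := (h' W hW).2
  rw [Finset.inf'_congr hne rfl key] at h1
  have h2 := map_finset_inf' (OrderIso.mulRight ((η v)⁻¹ * η' v)) hne η
  have h3 : W.inf' hne (fun w => η w * ((η v)⁻¹ * η' v)) = W.inf' hne η * ((η v)⁻¹ * η' v) :=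
    h2.symm
  rw [h3, (h W hW).2, one_mul, inv_mul_eq_one] at h1
  exact h1

variable [MulLeftMono G] [MulRightMono G]

/-- The top switching function `η_S`. -/
def topSwitching (S : Set E) : V → G := (Φ.exists_isTopSwitching S).choose

theorem topSwitching_spec (S : Set E) : Φ.IsTopSwitching S (Φ.topSwitching S) :=
  (Φ.exists_isTopSwitching S).choose_spec

variable {K : Type*} [AddCommSemigroup K] [MulAction Gᵐᵒᵖ K] (h : V → K)

/-- The contracted weight `h/S(W) = ∑_{w ∈ W} h(w) η_S(w)`; `G` acts on the weights from the
right. -/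
def contractWeight (S : Set E) (W : Finset V) (hW : W.Nonempty) : K :=
  W.nonemptySum hW fun w => MulOpposite.op (Φ.topSwitching S w) • h w

variable [Fintype E] {R : Type*} [CommRing R]

/-- The total dichromatic polynomial
`Q(u, v, z) = ∑_{S ⊆ E} v^(|S| - n + b(S)) z^(c(S) - b(S)) ∏_{W ∈ π_b(S)} u_{h/S(W)}`,
with the values of its variables in an arbitrary commutative ring.  The exponents are nonnegative
integers, so the subtractions do not truncate. -/
def totalDichromatic (u : K → R) (v z : R) : R :=
  ∑ S : Finset E, v ^ (S.card + Φ.numBal (S : Set E) - Fintype.card V) *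
    z ^ (Φ.numComp (S : Set E) - Φ.numBal (S : Set E)) *
    ∏ W : {W // W ∈ Φ.balParts (S : Set E)},
      u (Φ.contractWeight h (S : Set E) W.1 (balParts_nonempty W.2))

open Classical in
/-- The forest expansion `F_O(u, y) = ∑_F y^ε(F) ∏_{W ∈ π(F)} u_{h/F(W)}` over the spanning forests
`F`, with activities in the semimatroid of graph balance, i.e. the one associated with the complete
lift matroid and its basepoint. -/
def forestExpansion (O : LinearOrder E) (u : K → R) (y : R) : R :=
  ∑ F : Finset E with Φ.IsForest (F : Set E),
    y ^ Semimatroid.numExtActive Φ.liftMatroid O (F : Set E) *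
    ∏ W : {W // W ∈ Φ.parts (F : Set E)},
      u (Φ.contractWeight h (F : Set E) W.1 (parts_nonempty W.2))

end Weights

end GainGraph

/-! The balanced edge sets fall into Boolean intervals, one for each spanning forest, and each
forest term is the sum of `Q` over its interval.

Setting z = 0 in `Q` leaves only the sets S with c(S) = b(S), which are the balanced ones
(`totalDichromatic_zero`). Scan such an S in increasing order and keep each edge that the smaller
edges of S do not span: this gives a basis F of S, hence a spanning forest. An edge of S is rejected
exactly when the smaller edges of F span it, which is to say that it is the largest edge of its
fundamental circuit, so it is externally active. Conversely, adding any active edges to F leaves the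
greedy choice unchanged. Hence the sets with greedy basis F are those from F to F ∪ A, where A is
the set of active edges (`Semimatroid.greedyBasis_eq_iff`). All of them have the closure of F, which
omits e₀, so all are balanced.

Along an interval the closure is constant, so the components are too (`parts_eq_of_closure_eq`).
Uniqueness of the top switching function then fixes the contracted weights
(`contractWeight_eq_of_subset`). As n = |F| + c(F), the remaining factor is (y - 1)^(|S| - |F|), and
by the binomial theorem these powers add up to y^|A|. The order enters only through the choice of
intervals, so the total does not depend on it. -/

namespace Semimatroid

/-! ### Greedy bases and external activity -/

section GreedyBasis

variable {E : Type*} [LinearOrder E] {M : Matroid (Option E)} {S F : Set E} {e : E}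

/-- The points of `S` that are not in the closure of the smaller points of `S`. -/
def greedyBasis (M : Matroid (Option E)) (S : Set E) : Set E :=
  {e ∈ S | some e ∉ M.closure (some '' {f ∈ S | f < e})}

theorem greedyBasis_subset : greedyBasis M S ⊆ S := fun _ h => h.1

theorem closure_image_lt_mono {T : Set E} {a b : E} (h : T ⊆ S) (hab : a ≤ b) :
    M.closure (some '' {f ∈ T | f < a}) ⊆ M.closure (some '' {f ∈ S | f < b}) :=
  M.closure_subset_closure (Set.image_mono fun _ hf => ⟨h hf.1, hf.2.trans_le hab⟩)

/-- Strong induction on `e`: the smaller points of `S` span `e`, and each of them is either kept or,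
by induction, spanned by still smaller kept points. -/
theorem mem_closure_greedyBasis_lt [Finite E] (hM : M.E = Set.univ) (he : e ∈ S)
    (heB : e ∉ greedyBasis M S) :
    some e ∈ M.closure (some '' {f ∈ greedyBasis M S | f < e}) := by
  induction e using WellFoundedLT.induction with
  | ind e ih =>
    have h : some e ∈ M.closure (some '' {f ∈ S | f < e}) := by
      by_contra h
      exact heB ⟨he, h⟩
    refine M.closure_subset_closure_of_subset_closure ?_ h
    rintro _ ⟨f, ⟨hfS, hfe⟩, rfl⟩
    by_cases hfB : f ∈ greedyBasis M S
    · exact M.mem_closure_of_mem' ⟨f, ⟨hfB, hfe⟩, rfl⟩ (by simp [hM])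
    · exact closure_image_lt_mono subset_rfl hfe.le (ih f hfe hfS hfB)

theorem closure_greedyBasis [Finite E] (hM : M.E = Set.univ) :
    M.closure (some '' greedyBasis M S) = M.closure (some '' S) := by
  refine (M.closure_subset_closure (Set.image_mono greedyBasis_subset)).antisymm
    (M.closure_subset_closure_of_subset_closure ?_)
  rintro _ ⟨e, he, rfl⟩
  by_cases heB : e ∈ greedyBasis M S
  · exact M.mem_closure_of_mem' ⟨e, heB, rfl⟩ (by simp [hM])
  · exact M.closure_subset_closure (Set.image_mono fun _ hf => hf.1)
      (mem_closure_greedyBasis_lt hM he heB)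

/-- The largest point of a circuit is spanned by the others, which are smaller, so it could not have
been kept. -/
theorem indep_greedyBasis [Finite E] (hM : M.E = Set.univ) :
    M.Indep (some '' greedyBasis M S) := by
  rw [← M.not_dep_iff (by simp [hM])]
  intro hdep
  obtain ⟨C, hCB, hC⟩ := hdep.exists_isCircuit_subset
  have hne : (some ⁻¹' C).Nonempty := by
    obtain ⟨x, hx⟩ := hC.nonempty
    obtain ⟨e, -, rfl⟩ := hCB hx
    exact ⟨e, hx⟩
  obtain ⟨e, he, hmax⟩ := Set.exists_max_image _ id (Set.toFinite _) hne
  have heB : e ∈ greedyBasis M S := by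
    obtain ⟨f, hf, hfe⟩ := hCB he
    rwa [← Option.some_injective _ hfe]
  refine heB.2 (M.closure_subset_closure ?_ (hC.mem_closure_sdiff_singleton_of_mem he))
  rintro x ⟨hx, hxe⟩
  obtain ⟨f, hf, rfl⟩ := hCB hx
  exact ⟨f, ⟨hf.1, lt_of_le_of_ne (hmax f hx) fun h => hxe (by simpa using h)⟩, rfl⟩

/-- This puts activity in the same form as the greedy condition. The fundamental circuit of `e` lies
in every set `insert e J` with `J ⊆ F` spanning `e`; its points other than `e` are all smaller than
`e` exactly when the smaller points of `F` already span `e`. -/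
theorem externallyActive_iff (hF : SemiIndep M F) :
    ExternallyActive M ‹_› F e ↔ e ∉ F ∧ some e ∈ M.closure (some '' {f ∈ F | f < e}) := by
  constructor
  · rintro ⟨-, heF, hcl, hmax⟩
    refine ⟨heF, ?_⟩
    have hC := hF.1.fundCircuit_isCircuit hcl (by simpa using heF)
    refine M.closure_subset_closure ?_
      (hC.mem_closure_sdiff_singleton_of_mem (M.mem_fundCircuit _ _))
    rintro x ⟨hx, hxe⟩
    obtain rfl | ⟨f, hf, rfl⟩ := M.fundCircuit_subset_insert _ _ hx
    · exact absurd rfl hxe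
    · exact ⟨f, ⟨hf, lt_of_le_of_ne (hmax f hx) fun h => hxe (by simp [h])⟩, rfl⟩
  · rintro ⟨heF, hcl⟩
    have hsub : some '' {f ∈ F | f < e} ⊆ some '' F := Set.image_mono fun _ hf => hf.1
    have hcl' := M.closure_subset_closure hsub hcl
    refine ⟨hF, heF, hcl', fun f hf => ?_⟩
    -- The circuit is `e` together with the intersection of all subsets of `F` that span `e`; the
    -- set of smaller points of `F` is one of them.
    rw [Matroid.fundCircuit_eq_sInter hcl'] at hf
    obtain hf | hf := hf
    · exact (Option.some_injective _ hf).le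
    · obtain ⟨g, hg, hgf⟩ := hf _ ⟨hsub, hcl⟩
      rw [← Option.some_injective _ hgf]
      exact hg.2.le

/-- The sets with a given greedy basis form an interval. -/
theorem greedyBasis_eq_iff [Finite E] (hM : M.E = Set.univ) (hF : SemiIndep M F) :
    greedyBasis M S = F ↔ F ⊆ S ∧ S ⊆ F ∪ {e | ExternallyActive M ‹_› F e} := by
  constructor
  · rintro rfl
    refine ⟨greedyBasis_subset, fun e he => ?_⟩
    by_cases heB : e ∈ greedyBasis M S
    · exact .inl heB
    · exact .inr ((externallyActive_iff hF).2 ⟨heB, mem_closure_greedyBasis_lt hM he heB⟩)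
  · rintro ⟨hFS, hSF⟩
    have hact : ∀ e ∈ S, e ∉ F → some e ∈ M.closure (some '' {f ∈ F | f < e}) := fun e he heF =>
      ((externallyActive_iff hF).1 ((hSF he).resolve_left heF)).2
    ext e
    constructor
    · rintro ⟨he, hcl⟩
      by_contra heF
      exact hcl (closure_image_lt_mono hFS le_rfl (hact e he heF))
    · refine fun he => ⟨hFS he, fun hcl => ?_⟩
      -- If the smaller points of `S` spanned `e`, so would the smaller points of `F`, since those
      -- outside `F` are active; this contradicts the independence of `F`.
      refine hF.1.notMem_closure_sdiff_of_mem (Set.mem_image_of_mem some he)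
        (M.closure_subset_closure (X := some '' {f ∈ F | f < e}) ?_
          (M.closure_subset_closure_of_subset_closure ?_ hcl))
      · rintro _ ⟨f, hf, rfl⟩
        exact ⟨⟨f, hf.1, rfl⟩, fun h => hf.2.ne (by simpa using h)⟩
      · rintro _ ⟨f, ⟨hfS, hfe⟩, rfl⟩
        by_cases hfF : f ∈ F
        · exact M.mem_closure_of_mem' ⟨f, ⟨hfF, hfe⟩, rfl⟩ (by simp [hM])
        · exact closure_image_lt_mono subset_rfl hfe.le (hact f hfS hfF)

/-- Active points lie in the closure of `F` by definition. Constancy of the closure is what keeps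
balance constant along the interval. -/
theorem closure_of_subset_union_externallyActive (hFS : F ⊆ S)
    (hSF : S ⊆ F ∪ {e | ExternallyActive M ‹_› F e}) (hM : M.E = Set.univ) :
    M.closure (some '' S) = M.closure (some '' F) := by
  refine (M.closure_subset_closure_of_subset_closure ?_).antisymm
    (M.closure_subset_closure (Set.image_mono hFS))
  rintro _ ⟨e, he, rfl⟩
  obtain h | h := hSF he
  · exact M.mem_closure_of_mem' ⟨e, h, rfl⟩ (by simp [hM])
  · exact h.2.2.1

end GreedyBasis

end Semimatroid

namespace GainGraph

/-! ### Spanning forests and circles -/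

section Forest

variable {V E G : Type*} [Group G] {Φ : GainGraph V E G}

theorem IsForest.mono {F F' : Set E} (hF : Φ.IsForest F) (h : F' ⊆ F) : Φ.IsForest F' :=
  ⟨fun e he => hF.1 e (h he), fun v p hp hF' => hF.2 v p hp fun e he => h (hF' e he)⟩

theorem IsForest.balanced {F : Set E} (hF : Φ.IsForest F) : Φ.Balanced F :=
  ⟨fun e he => (hF.1 e he).1, fun v p hp h => absurd h (hF.2 v p hp)⟩

theorem exists_step_of_not_half_of_not_loose {e : E} (h : ¬ Φ.IsHalf e) (h' : ¬ Φ.IsLoose e) :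
    ∃ v w g, Φ.Step e v w g := by
  cases he : Φ.edge e with
  | arc v w g => exact ⟨v, w, g, .fwd he⟩
  | half v => exact absurd ⟨v, he⟩ h
  | loose => exact absurd he h'

theorem IsForest.not_conn {F : Set E} {e : E} (hF : Φ.IsForest (insert e F)) (he : e ∉ F)
    {v w : V} {g : G} (hst : Φ.Step e v w g) : ¬ Φ.Conn F v w := by
  intro hvw
  obtain ⟨p, hp⟩ := hvw.symm
  -- A forest is balanced for want of circles, so a walk in it can be shortened to a path; together
  -- with `e` this path closes up to a circle.
  obtain ⟨q, hq, hqF, -⟩ := (hF.mono (Set.subset_insert e F)).balanced.exists_path p hp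
  refine hF.2 v (.cons e g hst q) ⟨by simp [Walk.edges], ?_, by simpa [Walk.support] using hq⟩ ?_
  · simp only [Walk.edges, List.nodup_cons]
    exact ⟨fun h => he (hqF e h), q.edges_nodup hq⟩
  · simp only [Walk.edges, List.mem_cons, forall_eq_or_imp]
    exact ⟨Set.mem_insert e F, fun f hf => Set.mem_insert_of_mem e (hqF f hf)⟩

end Forest

/-! ### Closure, components and forests in the complete lift matroid -/

section ForestRank

variable {V E G : Type*} [Group G] [Fintype V] {Φ : GainGraph V E G}

theorem liftRank_image_some {S : Set E} (hS : Φ.Balanced S) :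
    Φ.liftRank (some '' S) = Fintype.card V - Φ.numComp S := by
  simp [liftRank, Set.preimage_image_eq _ (Option.some_injective E), hS]

/-- Reduces closure to `liftRank`, that is, to counting components and testing balance. -/
theorem mem_closure_liftMatroid [Finite E] {X : Set (Option E)} {x : Option E} :
    x ∈ Φ.liftMatroid.closure X ↔ Φ.liftRank (insert x X) = Φ.liftRank X := by
  constructor
  · intro hx
    have h := Φ.liftMatroid.eRk_insert_closure_eq x X
    rw [Set.insert_eq_of_mem hx, Matroid.eRk_closure_eq, liftMatroid_eRk, liftMatroid_eRk] at h
    exact_mod_cast h.symm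
  · intro h
    by_contra hx
    have h1 := Matroid.eRk_insert_eq_add_one (M := Φ.liftMatroid) ⟨Set.mem_univ x, hx⟩
    rw [liftMatroid_eRk, liftMatroid_eRk, h] at h1
    norm_cast at h1
    omega

/-- Adding e₀ does not affect the components, so it raises the rank exactly when the unbalance term
of `S` is still 0. -/
theorem semiBalanced_liftMatroid_iff [Finite E] {S : Set E} :
    Semimatroid.SemiBalanced Φ.liftMatroid S ↔ Φ.Balanced S := by
  rw [Semimatroid.SemiBalanced, mem_closure_liftMatroid]
  have h : (some ⁻¹' (insert none (some '' S)) : Set E) = S := by ext; simp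
  simp [liftRank, h, Set.preimage_image_eq _ (Option.some_injective E)]

/-- An edge between two components of a balanced set keeps it balanced and merges the two, so it
raises the rank and is not in the closure. -/
theorem conn_of_mem_closure [Finite E] {S : Set E} (hS : Φ.Balanced S) {e : E}
    (he : some e ∈ Φ.liftMatroid.closure (some '' S)) {v w : V} {g : G} (hst : Φ.Step e v w g) :
    Φ.Conn S v w := by
  by_contra hvw
  rw [mem_closure_liftMatroid, ← Set.image_insert_eq, liftRank_image_some hS,
    liftRank_image_some (hS.insert_bridge hst hvw)] at he
  have h1 := numComp_insert_of_not_conn hst hvw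
  -- Without this bound the truncated subtraction in the rank could hide the drop in the number of
  -- components.
  have h2 := Φ.numComp_le S
  omega

theorem conn_iff_of_closure_eq [Finite E] {S F : Set E} (hF : Φ.Balanced F) (hFS : F ⊆ S)
    (hcl : Φ.liftMatroid.closure (some '' S) = Φ.liftMatroid.closure (some '' F)) {v w : V} :
    Φ.Conn S v w ↔ Φ.Conn F v w := by
  rw [← Set.union_eq_self_of_subset_left hFS]
  refine conn_union_iff fun e he v w g hst => conn_of_mem_closure hF ?_ hst
  rw [← hcl]
  exact Φ.liftMatroid.mem_closure_of_mem' ⟨e, he, rfl⟩ (by simp [liftMatroid_ground])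

theorem parts_eq_of_closure_eq [Finite E] {S F : Set E} (hF : Φ.Balanced F) (hFS : F ⊆ S)
    (hcl : Φ.liftMatroid.closure (some '' S) = Φ.liftMatroid.closure (some '' F)) :
    Φ.parts S = Φ.parts F := by
  have : Φ.comp S = Φ.comp F := by
    ext v w
    rw [mem_comp, mem_comp, conn_iff_of_closure_eq hF hFS hcl]
  rw [parts, parts, this]

/-- Each forest edge joins two components of the forest built so far. In the main proof this turns
the exponent |S| - n + c(S) into |S| - |F|. -/
theorem IsForest.ncard_add_numComp [Finite E] {F : Set E} (hF : Φ.IsForest F) :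
    F.ncard + Φ.numComp F = Fintype.card V := by
  induction F, Set.toFinite F using Set.Finite.induction_on with
  | empty =>
    classical
    rw [Set.ncard_empty, zero_add, numComp, parts, Finset.card_image_of_injective, Finset.card_univ]
    intro v w h
    rw [comp_eq_iff] at h
    exact Conn.rec_step (r := Eq) (fun _ => rfl) (fun _ _ _ => Eq.trans) (by simp) h
  | @insert e F he _ ih =>
    obtain ⟨h1, h2⟩ := hF.1 e (Set.mem_insert e F)
    obtain ⟨v, w, g, hst⟩ := exists_step_of_not_half_of_not_loose h1 h2
    have h3 := numComp_insert_of_not_conn hst (hF.not_conn he hst)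
    have h4 := ih (hF.mono (Set.subset_insert e F))
    rw [Set.ncard_insert_of_notMem he]
    omega

/-- The spanning forests are the independent sets of the semimatroid of graph balance. -/
theorem isForest_iff_semiIndep [Finite E] {F : Set E} :
    Φ.IsForest F ↔ Semimatroid.SemiIndep Φ.liftMatroid F := by
  rw [Semimatroid.SemiIndep, semiBalanced_liftMatroid_iff]
  constructor
  · intro hF
    refine ⟨?_, hF.balanced⟩
    rw [liftMatroid_indep_iff, liftRank_image_some hF.balanced,
      Set.ncard_image_of_injective F (Option.some_injective E)]
    have := hF.ncard_add_numComp
    omega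
  · rintro ⟨hF, hb⟩
    -- Every edge of a balanced independent set is a bridge: otherwise deleting it would change
    -- neither the components nor the balance, so the remaining edges would span it.
    have key : ∀ e ∈ F, ¬ ∀ v w g, Φ.Step e v w g → Φ.Conn (F \ {e}) v w := by
      intro e he hconn
      refine hF.notMem_closure_sdiff_of_mem (Set.mem_image_of_mem some he) ?_
      have h1 : (some '' F \ {some e} : Set (Option E)) = some '' (F \ {e}) := by
        rw [Set.image_sdiff (Option.some_injective E), Set.image_singleton]
      have h2 := numComp_insert_of_conn hconn
      rw [Set.insert_sdiff_singleton, Set.insert_eq_of_mem he] at h2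
      rw [h1, mem_closure_liftMatroid, ← Set.image_insert_eq, Set.insert_sdiff_singleton,
        Set.insert_eq_of_mem he, liftRank_image_some hb,
        liftRank_image_some (hb.mono Set.sdiff_subset), h2]
    -- Loose edges and edges of circles are not bridges: the former cannot be traversed at all, and
    -- the ends of the latter are joined by the rest of the circle.
    refine ⟨fun e he => ⟨hb.1 e he, fun hl => key e he fun v w g hst => ?_⟩, fun v p hp hpF => ?_⟩
    · rw [IsLoose] at hl
      cases hst <;> simp_all
    · cases p with
      | nil => exact hp.1 rfl
      | @cons _ w _ e g hst p =>
        obtain ⟨-, hnd, -⟩ := hp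
        simp only [Walk.edges, List.nodup_cons] at hnd
        simp only [Walk.edges, List.mem_cons, forall_eq_or_imp] at hpF
        have hc : Φ.Conn (F \ {e}) w v :=
          ⟨p, fun f hf => ⟨hpF.2 f hf, fun h => hnd.1 (h ▸ hf)⟩⟩
        refine key e hpF.1 fun x y k hst' => ?_
        rcases hst.eq_or hst' with ⟨rfl, rfl, -⟩ | ⟨rfl, rfl, -⟩
        · exact hc.symm
        · exact hc

theorem balParts_eq_parts {S : Set E} (hS : Φ.Balanced S) : Φ.balParts S = Φ.parts S := by
  ext W
  rw [mem_balParts]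
  exact and_iff_left (hS.mono fun _ h => h.1)

/-- A set is balanced if all its components are. -/
theorem balanced_of_numBal_eq {S : Set E} (h : Φ.numBal S = Φ.numComp S) : Φ.Balanced S := by
  classical
  have hp : Φ.balParts S = Φ.parts S :=
    Finset.eq_of_subset_of_card_le (fun W hW => (mem_balParts.1 hW).1) h.ge
  have hb : ∀ v, Φ.Balanced (Φ.induce S (Φ.comp S v : Set V)) := fun v =>
    (mem_balParts.1 (hp ▸ mem_parts.2 ⟨v, rfl⟩ : Φ.comp S v ∈ Φ.balParts S)).2
  refine ⟨fun e he ⟨v, hv⟩ => (hb v).1 e ?_ ⟨v, hv⟩, fun v p _ hpS => (hb v).gain_closed p ?_⟩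
  · simp [induce, ends, hv, he, mem_comp_self]
  -- A walk in `S` that starts in the component of `v` never leaves it. Both ends are left free
  -- because the induction passes to the tail of a closed walk, which need not be closed.
  · have : ∀ {x y : V} (p : Φ.Walk x y), (∀ e ∈ p.edges, e ∈ S) → Φ.Conn S v x →
        ∀ e ∈ p.edges, e ∈ Φ.induce S (Φ.comp S v : Set V) := by
      intro x y p
      induction p with
      | nil => simp [Walk.edges]
      | cons f g hst p ih =>
        intro hp hx
        simp only [Walk.edges, List.mem_cons, forall_eq_or_imp] at hp ⊢
        have hy := hx.trans (Conn.step hp.1 hst)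
        exact ⟨mem_induce_of_step hp.1 hst (by simpa [mem_comp]) (by simpa [mem_comp]),
          ih hp.2 hy⟩
    exact this p hpS (Conn.refl v)

/-- Balance comes for free on the right-hand side: `S` and `F` have the same closure, and that of
the forest omits e₀. -/
theorem greedyBasis_eq_iff [Finite E] [LinearOrder E] {S F : Set E} (hF : Φ.IsForest F) :
    Φ.Balanced S ∧ Semimatroid.greedyBasis Φ.liftMatroid S = F ↔
      F ⊆ S ∧ S ⊆ F ∪ {e | Semimatroid.ExternallyActive Φ.liftMatroid ‹_› F e} := by
  have hF' := isForest_iff_semiIndep.1 hF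
  rw [Semimatroid.greedyBasis_eq_iff liftMatroid_ground hF', and_iff_right_iff_imp]
  rintro ⟨hFS, hSF⟩
  have hcl := Semimatroid.closure_of_subset_union_externallyActive hFS hSF liftMatroid_ground
  rw [← semiBalanced_liftMatroid_iff, Semimatroid.SemiBalanced, hcl]
  exact hF'.2

theorem isForest_greedyBasis [Finite E] [LinearOrder E] {S : Set E} (hS : Φ.Balanced S) :
    Φ.IsForest (Semimatroid.greedyBasis Φ.liftMatroid S) :=
  isForest_iff_semiIndep.2 ⟨Semimatroid.indep_greedyBasis liftMatroid_ground,
    semiBalanced_liftMatroid_iff.2 (hS.mono Semimatroid.greedyBasis_subset)⟩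

end ForestRank

/-! ### Constancy of the contracted weights -/

section ContractWeight

variable {V E G : Type*} [Group G] [Lattice G] [Fintype V] {Φ : GainGraph V E G}

/-- On a common balanced component `W` the smaller set imposes fewer switching conditions, while the
normalisation involves only the values on `W`. -/
theorem IsTopSwitching.mono {S F : Set E} {η : V → G} (hη : Φ.IsTopSwitching S η) (hFS : F ⊆ S)
    (h : Φ.balParts F ⊆ Φ.balParts S) : Φ.IsTopSwitching F η := fun W hW =>
  ⟨fun e he => (hη W (h hW)).1 e ⟨hFS he.1, he.2⟩, (hη W (h hW)).2⟩

variable [MulLeftMono G] [MulRightMono G] {K : Type*} [AddCommSemigroup K] [MulAction Gᵐᵒᵖ K]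

theorem contractWeight_eq_of_subset (h : V → K) {S F : Set E} (hFS : F ⊆ S)
    (hp : Φ.balParts F ⊆ Φ.balParts S) {W : Finset V} (hW : W ∈ Φ.balParts F) (hne : W.Nonempty) :
    Φ.contractWeight h S W hne = Φ.contractWeight h F W hne := by
  have hη := (Φ.topSwitching_spec S).mono hFS hp
  -- With a zero adjoined, the nonempty sums become ordinary finite sums, which can be compared term
  -- by term.
  rw [← WithZero.coe_inj, contractWeight, contractWeight, Finset.coe_nonemptySum,
    Finset.coe_nonemptySum]
  refine Finset.sum_congr rfl fun v hv => ?_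
  rw [hη.unique (Φ.topSwitching_spec F) hW hv]

end ContractWeight

end GainGraph

/-- Members of the interval are `F ∪ T` with `T ⊆ A`, so this is the binomial expansion of ((y - 1)
+ 1)^|A|. -/
theorem Finset.sum_interval_pow_sub_one {E R : Type*} [DecidableEq E] [CommRing R]
    {F A : Finset E} (hFA : Disjoint F A) (y : R) :
    ∑ S ∈ (F ∪ A).powerset with F ⊆ S, (y - 1) ^ (S.card - F.card) = y ^ A.card := by
  have h : ((F ∪ A).powerset.filter (F ⊆ ·)) = A.powerset.image (F ∪ ·) := by
    ext S
    simp only [Finset.mem_filter, Finset.mem_powerset, Finset.mem_image]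
    constructor
    · rintro ⟨h1, h2⟩
      exact ⟨S \ F, sdiff_le_iff.2 h1, Finset.union_sdiff_of_subset h2⟩
    · rintro ⟨T, hT, rfl⟩
      exact ⟨Finset.union_subset_union_right hT, Finset.subset_union_left⟩
  rw [h, Finset.sum_image]
  · have h1 := Finset.sum_pow_mul_eq_add_pow (y - 1) 1 A
    rw [sub_add_cancel] at h1
    rw [← h1]
    refine Finset.sum_congr rfl fun T hT => ?_
    rw [Finset.card_union_of_disjoint (hFA.mono_right (Finset.mem_powerset.1 hT))]
    simp
  · intro T hT T' hT' hTT'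
    have hd := hFA.mono_right (Finset.mem_powerset.1 hT)
    have hd' := hFA.mono_right (Finset.mem_powerset.1 hT')
    rw [← Finset.union_sdiff_cancel_left hd, ← Finset.union_sdiff_cancel_left hd']
    exact congrArg (· \ F) hTT'

namespace GainGraph

/-! ### Comparison of the two expansions -/

noncomputable section ForestExpansion

variable {V E G : Type*} [Group G] [Lattice G] [Fintype V] (Φ : GainGraph V E G)
  [MulLeftMono G] [MulRightMono G] {K : Type*} [AddCommSemigroup K] [MulAction Gᵐᵒᵖ K] (h : V → K)
  {R : Type*} [CommRing R]

/-- The product `∏_{W ∈ π_b(S)} u_{h/S(W)}`. -/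
def weightProd (u : K → R) (S : Set E) : R :=
  ∏ W : {W // W ∈ Φ.balParts S}, u (Φ.contractWeight h S W.1 (balParts_nonempty W.2))

variable {Φ} in
theorem weightProd_eq_of_subset (u : K → R) {S F : Set E} (hFS : F ⊆ S)
    (hp : Φ.balParts S = Φ.balParts F) : Φ.weightProd h u S = Φ.weightProd h u F := by
  refine Fintype.prod_equiv (Equiv.subtypeEquivRight fun W => by rw [hp]) _ _ fun W => ?_
  exact congrArg u (contractWeight_eq_of_subset h hFS hp.ge (hp ▸ W.2) _)

variable {Φ} in
theorem prod_parts_eq_weightProd (u : K → R) {F : Set E} (hF : Φ.Balanced F) :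
    ∏ W : {W // W ∈ Φ.parts F}, u (Φ.contractWeight h F W.1 (parts_nonempty W.2)) =
      Φ.weightProd h u F :=
  Fintype.prod_equiv (Equiv.subtypeEquivRight fun W => by rw [balParts_eq_parts hF]) _ _
    fun _ => rfl

variable [Fintype E]

open Classical in
-- The exponent of z counts the unbalanced components. It is 0 for balanced `S`, where 0^0 = 1, and
-- positive otherwise.
theorem totalDichromatic_zero (u : K → R) (v : R) :
    Φ.totalDichromatic h u v 0 = ∑ S ∈ Finset.univ.filter fun S : Finset E => Φ.Balanced (S : Set E),
      v ^ (S.card + Φ.numComp (S : Set E) - Fintype.card V) * Φ.weightProd h u (S : Set E) := by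
  rw [totalDichromatic, Finset.sum_filter]
  refine Finset.sum_congr rfl fun S _ => ?_
  split_ifs with hS
  · have h1 : Φ.numBal (S : Set E) = Φ.numComp (S : Set E) := by
      rw [numBal, balParts_eq_parts hS, numComp]
    rw [h1, Nat.sub_self, pow_zero, mul_one, weightProd]
  · have h1 : Φ.numBal (S : Set E) ≤ Φ.numComp (S : Set E) :=
      Finset.card_le_card fun W hW => (mem_balParts.1 hW).1
    have h2 : Φ.numBal (S : Set E) ≠ Φ.numComp (S : Set E) :=
      fun h => hS (balanced_of_numBal_eq h)
    rw [zero_pow (by omega), mul_zero, zero_mul]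

open Classical in
theorem forestExpansion_eq_sum (O : LinearOrder E) (u : K → R) (y : R) :
    Φ.forestExpansion h O u y =
      ∑ F ∈ Finset.univ.filter fun F : Finset E => Φ.IsForest (F : Set E),
        y ^ Semimatroid.numExtActive Φ.liftMatroid O (F : Set E) *
          Φ.weightProd h u (F : Set E) := by
  rw [forestExpansion]
  symm
  -- The index in `forestExpansion` elaborates to a `Set E`; the coercion from finsets is the
  -- bijection.
  refine Finset.sum_bij (fun F _ => (F : Set E)) (fun F hF => ?_)
    (fun F _ F' _ hFF' => Finset.coe_injective hFF') (fun F hF => ?_) fun F hF => ?_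
  · simpa using hF
  · exact ⟨(Set.toFinite F).toFinset, by simpa using (Finset.mem_filter.1 hF).2, by simp⟩
  · rw [prod_parts_eq_weightProd h u (Finset.mem_filter.1 hF).2.balanced]

theorem forestExpansion_eq_totalDichromatic (O : LinearOrder E) (u : K → R) (y : R) :
    Φ.forestExpansion h O u y = Φ.totalDichromatic h u (y - 1) 0 := by
  classical
  let B : Finset E → Finset E := fun S =>
    (Set.toFinite (Semimatroid.greedyBasis Φ.liftMatroid (S : Set E))).toFinset
  have hB : ∀ S : Finset E,
      (B S : Set E) = Semimatroid.greedyBasis Φ.liftMatroid (S : Set E) := fun S => by simp [B]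
  have hmaps : ∀ S ∈ Finset.univ.filter fun S : Finset E => Φ.Balanced (S : Set E),
      B S ∈ Finset.univ.filter fun F : Finset E => Φ.IsForest (F : Set E) := by
    intro S hS
    rw [Finset.mem_filter, hB]
    exact ⟨Finset.mem_univ _, isForest_greedyBasis (Finset.mem_filter.1 hS).2⟩
  -- The balanced sets are grouped by their greedy bases, so that one forest remains to be treated
  -- at a time.
  rw [totalDichromatic_zero, forestExpansion_eq_sum, ← Finset.sum_fiberwise_of_maps_to hmaps]
  refine Finset.sum_congr rfl fun F hF => ?_
  replace hF : Φ.IsForest (F : Set E) := (Finset.mem_filter.1 hF).2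
  let A : Finset E :=
    (Set.toFinite {e | Semimatroid.ExternallyActive Φ.liftMatroid O (F : Set E) e}).toFinset
  have hA : (A : Set E) = {e | Semimatroid.ExternallyActive Φ.liftMatroid O (F : Set E) e} := by
    simp [A]
  have hFA : Disjoint F A := by
    refine Finset.disjoint_right.2 fun e he => ?_
    rw [← Finset.mem_coe, hA] at he
    exact he.2.1
  have hcard : Semimatroid.numExtActive Φ.liftMatroid O (F : Set E) = A.card := by
    rw [Semimatroid.numExtActive, ← hA, Set.ncard_coe_finset]
  have hfib : ((Finset.univ.filter fun S : Finset E => Φ.Balanced (S : Set E)).filter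
      fun S => B S = F) = (F ∪ A).powerset.filter (F ⊆ ·) := by
    ext S
    rw [Finset.mem_filter, Finset.mem_filter, Finset.mem_filter, Finset.mem_powerset,
      ← Finset.coe_inj, hB, and_iff_right (Finset.mem_univ S), greedyBasis_eq_iff hF, ← hA,
      ← Finset.coe_union, Finset.coe_subset, Finset.coe_subset, and_comm]
  rw [hcard, hfib,
    ← Finset.sum_interval_pow_sub_one hFA, Finset.sum_mul]
  refine Finset.sum_congr rfl fun S hS => ?_
  have hS' := hS
  rw [← hfib, Finset.mem_filter, Finset.mem_filter, ← Finset.coe_inj, hB] at hS'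
  obtain ⟨⟨-, hSb⟩, hSF⟩ := hS'
  have hFS : (F : Set E) ⊆ S := Finset.coe_subset.2 (Finset.mem_filter.1 hS).2
  have hcl : Φ.liftMatroid.closure (some '' (S : Set E)) =
      Φ.liftMatroid.closure (some '' (F : Set E)) := by
    rw [← hSF, Semimatroid.closure_greedyBasis liftMatroid_ground]
  have hp := parts_eq_of_closure_eq hF.balanced hFS hcl
  have hn := hF.ncard_add_numComp
  rw [Set.ncard_coe_finset] at hn
  -- The weights of `S` are those of `F`, and the exponent is |S| + c(F) - (|F| + c(F)) = |S| - |F|.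
  rw [weightProd_eq_of_subset h u hFS
    (by rw [balParts_eq_parts hSb, balParts_eq_parts hF.balanced, hp]), numComp, hp,
    ← numComp, ← hn, Nat.add_sub_add_right]

end ForestExpansion

end GainGraph

theorem theoremT {V E G K R : Type*} [Fintype V] [Fintype E]
    [Group G] [Lattice G] [MulLeftMono G] [MulRightMono G]
    [AddCommSemigroup K] [MulAction Gᵐᵒᵖ K]
    (hact : ∀ (g : Gᵐᵒᵖ) (a b : K), g • (a + b) = g • a + g • b)
    [CommRing R] (Φ : GainGraph V E G) (h : V → K) (u : K → R) (y : R) :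
    (∀ O O' : LinearOrder E, Φ.forestExpansion h O u y = Φ.forestExpansion h O' u y) ∧
      ∀ O : LinearOrder E, Φ.forestExpansion h O u y = Φ.totalDichromatic h u (y - 1) 0 :=
  ⟨fun O O' => (Φ.forestExpansion_eq_totalDichromatic h O u y).trans
    (Φ.forestExpansion_eq_totalDichromatic h O' u y).symm,
    fun O => Φ.forestExpansion_eq_totalDichromatic h O u y⟩
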